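/- Let $A \neq \{0\}$ be a unital commutative $C^*$-algebra. If $A$ is computably presentable, then its spectrum $\Delta(A)$, i.e. the set of nonzero homomorphisms $A \to \mathbb{C}$ with the weakest topology making all evaluation maps continuous, has a computably compact presentation. Here the following definitions are used. (a) A presentation of a $C^*$-algebra $A$ is a sequence $(v_n)_{n\in\mathbb{N}}$ in $A$ that generates a dense $*$-subalgebra of $A$. Fix an effective enumeration $(\mathfrak{p}_j)_{j\in\mathbb{N}}$ of the free (not necessarily unital) $*$-algebra over $\mathbb{Q}(i)$ on indeterminates $x_0,x_1,\dots$; the $j$-th rational vector of the presentation is obtained from $\mathfrak{p}_j$ by substituting $v_n$ for $x_n$ for every $n$. The presentation is computable if there is an algorithm that, given $j,k\in\mathbb{N}$, computes a rational number $q$ such that $|q-\|v\||<2^{-k}$, where $v$ is the $j$-th rational vector. The algebra $A$ is computably presentable if it has a computable presentation. (b) A computable presentation of a Polish space $X$ consists of a complete metric $d$ inducing the topology of $X$ and a dense sequence $(p_n)_{n\in\mathbb{N}}$ of points of $X$ such that there is an algorithm that, given $m,n,k\in\mathbb{N}$, computes a rational number $q$ with $|q-d(p_m,p_n)|<2^{-k}$.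 It is computably compact if there is an algorithm that, given $k\in\mathbb{N}$, computes $n_0,\dots,n_t\in\mathbb{N}$ such that $X=\bigcup_{j\le t}B(p_{n_j};2^{-k})$. -/

import Mathlib

namespace CompGelfand

/-- Codes for rational numbers: `(a, b, c)` stands for `(a - b) / (c + 1)`. -/
abbrev RatCode : Type := ℕ × ℕ × ℕ

/-- The rational number with a given code. Every rational number has a code. -/
def RatCode.toRat (q : RatCode) : ℚ := ((q.1 : ℚ) - (q.2.1 : ℚ)) / ((q.2.2 : ℚ) + 1)

/-- A family of reals is computable if there is an algorithm that, given an index `a` and `k`,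
computes a rational number `q` with `|q - x a| < 2⁻ᵏ`. -/
def IsComputableFamily {α : Type*} [Primcodable α] (x : α → ℝ) : Prop :=
  ∃ q : α → ℕ → RatCode, Computable₂ q ∧
    ∀ a k, |(((q a k).toRat : ℚ) : ℝ) - x a| < (2 : ℝ)⁻¹ ^ k

/-- Letters of the free `*`-algebra on `x₀, x₁, …`: `(n, false)` is `xₙ` and `(n, true)` is
`xₙ*`. -/
abbrev Letter : Type := ℕ × Bool

/-- Nonempty words: a first letter and the list of the following ones. -/
abbrev Word : Type := Letter × List Letter

/-- Codes for the elements of the free (not necessarily unital) `*`-algebra on `x₀, x₁, …`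
over `ℚ(i)`: finite formal sums of terms `(r + s i) w`, where `r`, `s` are (codes of) rational
numbers and `w` is a nonempty word. -/
abbrev RatStarPoly : Type := List ((RatCode × RatCode) × Word)

section Eval

variable {A : Type*} [NonUnitalCStarAlgebra A]

/-- The value of a letter when `v n` is substituted for `xₙ`. -/
def evalLetter (v : ℕ → A) (l : Letter) : A := if l.2 then star (v l.1) else v l.1

/-- The value of a word: the product of the values of its letters, from left to right. -/
def evalWord (v : ℕ → A) (w : Word) : A :=
  w.2.foldl (fun a l => a * evalLetter v l) (evalLetter v w.1)

/-- The complex number `r + s i` given by a pair of codes of rational numbers. -/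
noncomputable def evalCoeff (c : RatCode × RatCode) : ℂ :=
  (c.1.toRat : ℂ) + (c.2.toRat : ℂ) * Complex.I

/-- The value of a rational `*`-polynomial when `v n` is substituted for `xₙ`. -/
noncomputable def evalPoly (v : ℕ → A) (p : RatStarPoly) : A :=
  (p.map fun t => evalCoeff t.1 • evalWord v t.2).sum

end Eval

/-- A presentation of a C⋆-algebra `A`: a sequence of vectors that generates a dense
`*`-subalgebra of `A`. -/
structure CStarPresentation (A : Type*) [NonUnitalCStarAlgebra A] where
  gen : ℕ → A
  dense_adjoin : Dense (NonUnitalStarAlgebra.adjoin ℂ (Set.range gen) : Set A)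

/-- The rational vector of a presentation with index `p`. -/
noncomputable def CStarPresentation.rationalVector {A : Type*} [NonUnitalCStarAlgebra A]
    (P : CStarPresentation A) (p : RatStarPoly) : A :=
  evalPoly P.gen p

/-- A presentation is computable if the norm is computable on the rational vectors. -/
def CStarPresentation.IsComputable {A : Type*} [NonUnitalCStarAlgebra A]
    (P : CStarPresentation A) : Prop :=
  IsComputableFamily fun p : RatStarPoly => ‖P.rationalVector p‖

/-- A C⋆-algebra is computably presentable if it has a computable presentation. -/
def ComputablyPresentable (A : Type*) [NonUnitalCStarAlgebra A] : Prop :=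
  ∃ P : CStarPresentation A, P.IsComputable

/-- A presentation of a Polish space `X`: a complete metric that induces the topology of `X`,
together with a dense sequence of points. -/
structure PolishPresentation (X : Type*) [τ : TopologicalSpace X] where
  metric : MetricSpace X
  compatible : metric.toUniformSpace.toTopologicalSpace = τ
  complete : @CompleteSpace X metric.toUniformSpace
  point : ℕ → X
  dense_point : DenseRange point

/-- A presentation of a Polish space is computable if the array of distances between its
distinguished points is computable. -/
def PolishPresentation.IsComputable {X : Type*} [TopologicalSpace X]
    (P : PolishPresentation X) : Prop :=
  IsComputableFamily fun mn : ℕ × ℕ => P.metric.dist (P.point mn.1) (P.point mn.2)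

/-- A presentation of a Polish space is computably compact if it is computable and there is an
algorithm that, given `k`, computes (indices of) finitely many distinguished points such that the
open balls of radius `2⁻ᵏ` around them cover the space. -/
def PolishPresentation.IsComputablyCompact {X : Type*} [TopologicalSpace X]
    (P : PolishPresentation X) : Prop :=
  P.IsComputable ∧ ∃ f : ℕ → List ℕ, Computable f ∧
    ∀ k, ∀ x : X, ∃ n ∈ f k, P.metric.dist x (P.point n) < (2 : ℝ)⁻¹ ^ k

/-- The space `X` has a computably compact presentation. -/
def HasComputablyCompactPresentation (X : Type*) [TopologicalSpace X] : Prop :=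
  ∃ P : PolishPresentation X, P.IsComputablyCompact

end CompGelfand

/-! By Gelfand duality, norms in `A` are maxima over the spectrum. Scaled real and imaginary parts
of the generators are self-adjoint contractions `u i`, and the functions φ ↦ Re φ(u i) separate
characters, so they embed the spectrum in the cube [-1, 1]^ℕ. For finitely many constraints, the
penalty ∑ C (Re φ(u i) - q)² is at most a natural number K. Since K minus the penalty is the Gelfand
transform of an element of `A`, the norm of that element is K minus the least penalty. Thus a
computable norm makes the least penalty computable (`isComputableFamily_capSum_sub_norm`). As the
unit need not be a rational vector, constant terms use rational vectors that converge to 1 at a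
known rate (`norm_evalPoly_unitApprox_sub_one_le`).

Least penalties certify that a small box of the cube meets the spectrum. A search through ever finer
boxes, with all earlier constraints kept, always succeeds; compactness yields a point that satisfies
every constraint (`exists_computable_points`). The point itself is never computed, but the codes of
its boxes are, and they determine its coordinates and hence distances. Starting the search in each
box of a given level that lies close enough to the spectrum gives points whose balls cover it
(`hasComputablyCompactPresentation_of_penalty`). -/

namespace CompGelfand

/-! ### Computable search and list operations -/

section Computability

variable {α β γ σ : Type*} [Primcodable α] [Primcodable β] [Primcodable γ] [Primcodable σ]

theorem exists_computable_choice {p : α → ℕ → Bool} (hp : Computable₂ p)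
    (h : ∀ a, ∃ n, p a n = true) : ∃ f : α → ℕ, Computable f ∧ ∀ a, p a (f a) = true := by
  have hd : ∀ a, (Nat.rfind fun n => (Part.some (p a n) : Part Bool)).Dom := fun a => by
    obtain ⟨n, hn⟩ := h a
    obtain ⟨m, hm, -⟩ := Nat.rfind_min' hn
    exact Part.dom_iff_mem.2 ⟨m, hm⟩
  refine ⟨fun a => (Nat.rfind fun n => (Part.some (p a n) : Part Bool)).get (hd a),
    (Partrec.rfind (Computable₂.partrec₂ hp)).of_eq_tot fun a => Part.get_mem _, fun a => ?_⟩
  exact (Part.mem_some_iff.1 (Nat.rfind_spec (Part.get_mem (hd a)))).symm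

theorem computable_list_foldl {f : α → List β} {g : α → σ} {h : α → σ × β → σ}
    (hf : Computable f) (hg : Computable g) (hh : Computable₂ h) :
    Computable fun a => (f a).foldl (fun s b => h a (s, b)) (g a) := by
  -- The fold is a recursion on the index. The `none` branch is never reached below the length of
  -- the list.
  have key : Computable fun a => Nat.rec (motive := fun _ => σ) (g a)
      (fun n s => Option.casesOn (f a)[n]? s fun b => h a (s, b)) (f a).length := by
    refine Computable.nat_rec (Computable.list_length.comp hf) hg (h := fun a ns =>
      Option.casesOn (f a)[ns.1]? ns.2 fun b => h a (ns.2, b)) ?_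
    refine Computable.option_casesOn (o := fun x : α × ℕ × σ => (f x.1)[x.2.1]?)
      (f := fun x => x.2.2) (g := fun x b => h x.1 (x.2.2, b)) ?_ ?_ ?_
    · exact Computable.list_getElem?.comp (hf.comp .fst) (Computable.fst.comp .snd)
    · exact Computable.snd.comp .snd
    · exact hh.comp (Computable.fst.comp .fst)
        (Computable.pair (Computable.snd.comp (Computable.snd.comp .fst)) .snd)
  refine key.of_eq fun a => ?_
  have aux : ∀ n ≤ (f a).length, Nat.rec (motive := fun _ => σ) (g a)
      (fun n s => Option.casesOn (f a)[n]? s fun b => h a (s, b)) n =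
        ((f a).take n).foldl (fun s b => h a (s, b)) (g a) := by
    intro n
    induction n with
    | zero => simp
    | succ n ih =>
      intro hn
      have hn' : n < (f a).length := hn
      simp only [ih hn'.le, List.getElem?_eq_getElem hn']
      rw [← List.take_concat_get' _ _ hn', List.foldl_append]
      rfl
  rw [aux _ le_rfl, List.take_length]

theorem computable_list_flatMap {f : α → List β} {g : α → β → List σ}
    (hf : Computable f) (hg : Computable₂ g) :
    Computable fun a => (f a).flatMap (g a) := by
  refine (computable_list_foldl (h := fun a sb => sb.1 ++ g a sb.2) hf
    (Computable.const []) ?_).of_eq fun a => ?_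
  · exact Computable.list_append.comp (Computable.fst.comp .snd)
      (hg.comp .fst (Computable.snd.comp .snd))
  · have aux : ∀ (l : List β) (s : List σ), l.foldl (fun s b => s ++ g a b) s =
        s ++ l.flatMap (g a) := by
      intro l
      induction l with
      | nil => simp
      | cons b l ih => intro s; simp [ih]
    simpa using aux (f a) []

theorem computable_list_map {f : α → List β} {g : α → β → σ}
    (hf : Computable f) (hg : Computable₂ g) : Computable fun a => (f a).map (g a) := by
  refine (computable_list_flatMap hf (g := fun a b => [g a b]) ?_).of_eq fun a => ?_
  · exact Computable.list_cons.comp hg (Computable.const [])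
  · exact (List.map_eq_flatMap).symm

theorem computable_list_sum {f : α → List ℕ} (hf : Computable f) :
    Computable fun a => (f a).sum := by
  refine (computable_list_foldl (h := fun _ sb => sb.1 + sb.2) hf (Computable.const 0)
    ?_).of_eq fun a => ?_
  · exact Primrec.nat_add.to_comp.comp (Computable.fst.comp .snd) (Computable.snd.comp .snd)
  · exact (List.sum_eq_foldl).symm

theorem primrec_nat_pow : Primrec₂ fun m n : ℕ => m ^ n := by
  refine (Primrec.nat_rec' (f := fun p : ℕ × ℕ => p.2) (g := fun _ => 1)
    (h := fun p ns => ns.2 * p.1) Primrec.snd (Primrec.const 1) ?_).of_eq fun p => ?_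
  · exact Primrec.nat_mul.comp (Primrec.snd.comp .snd) (Primrec.fst.comp .fst)
  · induction p.2 with
    | zero => simp
    | succ n ih => simp only [ih, pow_succ]

end Computability

/-! ### Penalties and grids in the cube -/

/-- A constraint `(i, q, C)` penalizes the distance of the `i`-th coordinate to the rational number
coded by `q`, with weight `C`. -/
abbrev Constraint : Type := ℕ × RatCode × ℕ

/-- The total penalty `∑ C (h i x - q)²` of a point for a list of constraints `(i, q, C)`. -/
noncomputable def penalty {X : Type*} (h : ℕ → X → ℝ) (s : List Constraint) (x : X) : ℝ :=
  (s.map fun e => (e.2.2 : ℝ) * (h e.1 x - (e.2.1.toRat : ℚ)) ^ 2).sum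

/-- The number of grid steps in a unit interval at level `j`. -/
def gridScale (j : ℕ) : ℕ := 2 ^ (2 * j + 3)

/-- The `i`-th digit of the code `r` of a cell of the grid of level `j`. -/
def gridDigit (j r i : ℕ) : ℕ := r / (2 * gridScale j + 1) ^ i % (2 * gridScale j + 1)

/-- The constraints that locate the first `j` coordinates near the `r`-th grid point of level `j`
of the cube `[-1, 1]ʲ`. -/
def gridCell (j r : ℕ) : List Constraint :=
  (List.range j).map fun i => (i, (gridDigit j r i, gridScale j, gridScale j - 1), 4 ^ (j + 1))

theorem gridScale_pos (j : ℕ) : 0 < gridScale j := by unfold gridScale; positivity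

theorem toRat_grid (j a : ℕ) :
    ((RatCode.toRat (a, gridScale j, gridScale j - 1) : ℚ) : ℝ) =
      ((a : ℝ) - gridScale j) / gridScale j := by
  simp only [RatCode.toRat]
  have h : 1 ≤ gridScale j := gridScale_pos j
  push_cast [Nat.cast_sub h]
  simp

section Penalty

variable {X : Type*} (h : ℕ → X → ℝ)

theorem penalty_nil (x : X) : penalty h [] x = 0 := rfl

theorem penalty_append (s t : List Constraint) (x : X) :
    penalty h (s ++ t) x = penalty h s x + penalty h t x := by
  simp [penalty]

theorem penalty_nonneg (s : List Constraint) (x : X) : 0 ≤ penalty h s x := by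
  refine List.sum_nonneg fun y hy => ?_
  obtain ⟨e, -, rfl⟩ := List.mem_map.1 hy
  positivity

theorem continuous_penalty [TopologicalSpace X] (hc : ∀ i, Continuous (h i))
    (s : List Constraint) : Continuous (penalty h s) := by
  induction s with
  | nil => exact continuous_const
  | cons e s ih =>
    have : penalty h (e :: s) =
        fun x => (e.2.2 : ℝ) * (h e.1 x - (e.2.1.toRat : ℚ)) ^ 2 + penalty h s x := by
      ext x; simp [penalty]
    rw [this]
    have := hc e.1
    fun_prop

theorem penalty_gridCell (j r : ℕ) (x : X) : penalty h (gridCell j r) x =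
    ∑ i ∈ Finset.range j,
      4 ^ (j + 1) * (h i x - ((gridDigit j r i : ℝ) - gridScale j) / gridScale j) ^ 2 := by
  simp only [penalty, gridCell, List.map_map, Function.comp_def, toRat_grid]
  rw [← List.sum_toFinset _ List.nodup_range, List.toFinset_range]
  push_cast
  rfl

/-- Each summand is at most 1, and the weight 4^(j+1) is the square of 2^(j+1). -/
theorem abs_sub_le_of_penalty_le_one {j r i : ℕ} {x : X} (hx : penalty h (gridCell j r) x ≤ 1)
    (hi : i < j) :
    |h i x - ((gridDigit j r i : ℝ) - gridScale j) / gridScale j| ≤ (2 : ℝ)⁻¹ ^ (j + 1) := by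
  rw [penalty_gridCell] at hx
  set y := h i x - ((gridDigit j r i : ℝ) - gridScale j) / gridScale j with hy
  have h1 : 4 ^ (j + 1) * y ^ 2 ≤ 1 := by
    refine le_trans ?_ hx
    exact Finset.single_le_sum (f := fun i => 4 ^ (j + 1) *
      (h i x - ((gridDigit j r i : ℝ) - gridScale j) / gridScale j) ^ 2)
      (fun i _ => by positivity) (Finset.mem_range.2 hi)
  have h2 : (2 ^ (j + 1) * y) ^ 2 ≤ 1 := by
    rw [mul_pow, ← pow_mul, mul_comm (j + 1) 2, pow_mul]
    norm_num at h1 ⊢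
    exact h1
  have h3 : |2 ^ (j + 1) * y| ≤ 1 := (sq_le_one_iff_abs_le_one _).1 h2
  rw [abs_mul, abs_of_pos (by positivity)] at h3
  rw [inv_pow, ← one_div, le_div_iff₀ (by positivity), mul_comm]
  exact h3

/-- Rounding each coordinate down to the grid costs at most 1/D per coordinate. The scale D = 8 ·
4^j is so fine that even the weighted sum of squares stays far below the threshold 1. -/
theorem exists_gridCell (hb : ∀ i x, |h i x| ≤ 1) (j : ℕ) (x : X) :
    ∃ r < (2 * gridScale j + 1) ^ j, penalty h (gridCell j r) x ≤ (2 : ℝ)⁻¹ ^ (j + 3) := by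
  set D := gridScale j with hD
  have hD0 : (0 : ℝ) < D := by exact_mod_cast gridScale_pos j
  have hlt : ∀ i : Fin j, ⌊(h i x + 1) * D⌋₊ < 2 * D + 1 := fun i => by
    have : (h i x + 1) * D ≤ 2 * D := by
      have := (abs_le.1 (hb i x)).2
      nlinarith
    rw [Nat.lt_succ_iff]
    exact Nat.floor_le_of_le (by push_cast; exact this)
  let F : Fin j → Fin (2 * D + 1) := fun i => ⟨_, hlt i⟩
  refine ⟨finFunctionFinEquiv F, (finFunctionFinEquiv F).2, ?_⟩
  -- `finFunctionFinEquiv` encodes a tuple by its base 2D + 1 expansion, which `gridDigit` reads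
  -- off.
  have hdig : ∀ i : Fin j, gridDigit j (finFunctionFinEquiv F) i = ⌊(h i x + 1) * D⌋₊ := fun i =>
    congrArg Fin.val (congrFun (finFunctionFinEquiv.symm_apply_apply F) i)
  rw [penalty_gridCell]
  have hterm : ∀ i ∈ Finset.range j, (4 : ℝ) ^ (j + 1) *
      (h i x - ((gridDigit j (finFunctionFinEquiv F) i : ℝ) - D) / D) ^ 2 ≤
        4 ^ (j + 1) * (1 / D) ^ 2 := by
    intro i hi
    rw [hdig ⟨i, Finset.mem_range.1 hi⟩]
    have hnn : 0 ≤ (h i x + 1) * D := by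
      have := (abs_le.1 (hb i x)).1
      exact mul_nonneg (by linarith) hD0.le
    have h1 := Nat.floor_le hnn
    have h2 := Nat.lt_floor_add_one ((h i x + 1) * D)
    have h3 : h i x - ((⌊(h i x + 1) * D⌋₊ : ℝ) - D) / D =
        ((h i x + 1) * D - ⌊(h i x + 1) * D⌋₊) / D := by
      field_simp; ring
    rw [h3]
    have h4 : (h i x + 1) * D - ⌊(h i x + 1) * D⌋₊ ≤ 1 := by linarith
    have h5 : 0 ≤ (h i x + 1) * D - ⌊(h i x + 1) * D⌋₊ := by linarith
    gcongr
  refine (Finset.sum_le_sum hterm).trans ?_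
  have hj : (j : ℝ) ≤ 2 ^ j := by exact_mod_cast Nat.lt_two_pow_self.le
  have hDv : (D : ℝ) = 2 ^ j * 2 ^ j * 8 := by
    rw [hD, gridScale]; push_cast; ring
  have h4 : (4 : ℝ) ^ j = 2 ^ j * 2 ^ j := by rw [← mul_pow]; norm_num
  simp only [Finset.sum_const, Finset.card_range, nsmul_eq_mul, hDv, inv_pow, pow_succ, h4, pow_zero]
  have hp : (0 : ℝ) < 2 ^ j := by positivity
  generalize (2 : ℝ) ^ j = p at *
  -- With p = 2^j the claim is j / (16 p²) ≤ p / (8 p²), which follows from j ≤ p.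
  rw [show (j : ℝ) * (p * p * 4 * (1 * (1 / (p * p * 8)) * (1 / (p * p * 8)))) =
    j / (16 * (p * p)) by field_simp; ring, show p⁻¹ * 2⁻¹ * 2⁻¹ * 2⁻¹ = p / (8 * (p * p)) by
      field_simp; norm_num, div_le_div_iff₀ (by positivity) (by positivity)]
  nlinarith [mul_pos hp hp]
end Penalty

/-! ### Computability of the grid and of the threshold test -/

theorem primrec_gridScale : Primrec gridScale :=
  primrec_nat_pow.comp (.const 2)
    (Primrec.nat_add.comp (Primrec.nat_mul.comp (.const 2) .id) (.const 3))

theorem primrec_gridDigit {α : Type*} [Primcodable α] {f g k : α → ℕ} (hf : Primrec f)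
    (hg : Primrec g) (hk : Primrec k) : Primrec fun a => gridDigit (f a) (g a) (k a) := by
  have hL : Primrec fun a => 2 * gridScale (f a) + 1 :=
    Primrec.succ.comp (Primrec.nat_mul.comp (.const 2) (primrec_gridScale.comp hf))
  exact Primrec.nat_mod.comp (Primrec.nat_div.comp hg (primrec_nat_pow.comp hL hk)) hL

theorem primrec_gridCell : Primrec₂ gridCell := by
  refine Primrec.list_map (Primrec.list_range.comp .fst) (g := fun (p : ℕ × ℕ) i =>
    (i, (gridDigit p.1 p.2 i, gridScale p.1, gridScale p.1 - 1), 4 ^ (p.1 + 1))) ?_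
  have h1 : Primrec fun x : (ℕ × ℕ) × ℕ => gridScale x.1.1 :=
    primrec_gridScale.comp (Primrec.fst.comp .fst)
  have h2 : Primrec fun x : (ℕ × ℕ) × ℕ => gridDigit x.1.1 x.1.2 x.2 :=
    primrec_gridDigit (Primrec.fst.comp .fst) (Primrec.snd.comp .fst) .snd
  have h3 : Primrec fun x : (ℕ × ℕ) × ℕ => 4 ^ (x.1.1 + 1) :=
    primrec_nat_pow.comp (.const 4) (Primrec.succ.comp (Primrec.fst.comp .fst))
  exact Primrec.pair .snd (Primrec.pair (Primrec.pair h2 (Primrec.pair h1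
    (Primrec.pred.comp h1))) h3)

/-- Whether the rational number coded by `c` is less than `1 - 2⁻⁽ʲ⁺¹⁾`. -/
def thresholdTest (c : RatCode) (j : ℕ) : Bool :=
  decide (c.1 * 2 ^ (j + 1) + (c.2.2 + 1) < c.2.1 * 2 ^ (j + 1) + (c.2.2 + 1) * 2 ^ (j + 1))

/-- Whether the approximation `q s (j + 4)` is less than `1 - 2⁻⁽ʲ⁺¹⁾`. -/
def approxTest (q : List Constraint → ℕ → RatCode) (s : List Constraint) (j : ℕ) : Bool :=
  thresholdTest (q s (j + 4)) j

theorem primrec_thresholdTest : Primrec₂ thresholdTest := by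
  have ha : Primrec fun x : RatCode × ℕ => x.1.1 := Primrec.fst.comp .fst
  have hb : Primrec fun x : RatCode × ℕ => x.1.2.1 := Primrec.fst.comp (Primrec.snd.comp .fst)
  have hc : Primrec fun x : RatCode × ℕ => x.1.2.2 + 1 :=
    Primrec.succ.comp (Primrec.snd.comp (Primrec.snd.comp .fst))
  have hp : Primrec fun x : RatCode × ℕ => 2 ^ (x.2 + 1) :=
    primrec_nat_pow.comp (.const 2) (Primrec.succ.comp .snd)
  have hl := Primrec.nat_add.comp (Primrec.nat_mul.comp ha hp) hc
  have hr := Primrec.nat_add.comp (Primrec.nat_mul.comp hb hp) (Primrec.nat_mul.comp hc hp)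
  exact (PrimrecRel.comp Primrec.nat_lt hl hr).decide

theorem computable_approxTest {q : List Constraint → ℕ → RatCode} (hq : Computable₂ q) :
    Computable₂ (approxTest q) := by
  have h2 : Computable fun x : List Constraint × ℕ => q x.1 (x.2 + 4) :=
    hq.comp .fst (Primrec.nat_add.to_comp.comp .snd (.const 4))
  exact primrec_thresholdTest.to_comp.comp h2 .snd

theorem approxTest_eq_true_iff (q : List Constraint → ℕ → RatCode) (s : List Constraint) (j : ℕ) :
    approxTest q s j = true ↔
      (((q s (j + 4)).toRat : ℚ) : ℝ) < 1 - (2 : ℝ)⁻¹ ^ (j + 1) := by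
  rw [approxTest, thresholdTest, decide_eq_true_iff, RatCode.toRat]
  generalize q s (j + 4) = c
  push_cast
  rw [div_lt_iff₀ (by positivity), ← Nat.cast_lt (α := ℝ)]
  push_cast
  have hp : (0 : ℝ) < 2 ^ (j + 1) := by positivity
  rw [inv_pow]
  generalize (2 : ℝ) ^ (j + 1) = p at *
  rw [← mul_lt_mul_iff_of_pos_right (b := (c.1 : ℝ) - c.2.1) hp]
  have : (1 - p⁻¹) * ((c.2.2 : ℝ) + 1) * p = (c.2.2 + 1) * p - (c.2.2 + 1) := by
    field_simp
  rw [this]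
  constructor <;> intro h <;> linarith

/-! ### Points obtained by searching through nested boxes -/

section Points

variable {X : Type*} {h : ℕ → X → ℝ}

theorem lt_one_of_approxTest {M : List Constraint → ℝ} {q : List Constraint → ℕ → RatCode}
    (hqM : ∀ s k, |(((q s k).toRat : ℚ) : ℝ) - M s| < (2 : ℝ)⁻¹ ^ k) {s : List Constraint} {j : ℕ}
    (hs : approxTest q s j = true) :
    M s < 1 - (2 : ℝ)⁻¹ ^ (j + 1) + (2 : ℝ)⁻¹ ^ (j + 4) := by
  rw [approxTest_eq_true_iff] at hs
  have := (abs_lt.1 (hqM s (j + 4))).1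
  linarith

theorem approxTest_of_le {M : List Constraint → ℝ} {q : List Constraint → ℕ → RatCode}
    (hqM : ∀ s k, |(((q s k).toRat : ℚ) : ℝ) - M s| < (2 : ℝ)⁻¹ ^ k) {s : List Constraint} {j : ℕ}
    (hs : M s + (2 : ℝ)⁻¹ ^ (j + 4) ≤ 1 - (2 : ℝ)⁻¹ ^ (j + 1)) : approxTest q s j = true := by
  rw [approxTest_eq_true_iff]
  have := (abs_lt.1 (hqM s (j + 4))).2
  linarith

/-- The thresholds 1 - 2^-(j+1) increase to 1, which leaves room at each level: at a minimizer for
`s`, a suitable new cell costs at most 2^-(j+4), and this together with the approximation errors is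
less than the increase 2^-(j+2) of the threshold. -/
theorem exists_approxTest_append (hb : ∀ i x, |h i x| ≤ 1) {M : List Constraint → ℝ}
    {q : List Constraint → ℕ → RatCode}
    (hqM : ∀ s k, |(((q s k).toRat : ℚ) : ℝ) - M s| < (2 : ℝ)⁻¹ ^ k)
    (hle : ∀ s x, M s ≤ penalty h s x) (hex : ∀ s, ∃ x, penalty h s x = M s)
    {s : List Constraint} {j : ℕ} (hs : approxTest q s j = true) :
    ∃ r, approxTest q (s ++ gridCell (j + 1) r) (j + 1) = true := by
  obtain ⟨x, hx⟩ := hex s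
  obtain ⟨r, -, hr⟩ := exists_gridCell h hb (j + 1) x
  refine ⟨r, approxTest_of_le hqM ?_⟩
  have h1 := hle (s ++ gridCell (j + 1) r) x
  rw [penalty_append, hx] at h1
  have h2 := lt_one_of_approxTest hqM hs
  have hp : (0 : ℝ) < 2⁻¹ ^ j := by positivity
  simp only [pow_succ] at *
  linarith

theorem exists_computable_points [TopologicalSpace X] [CompactSpace X] (hc : ∀ i, Continuous (h i)) (hb : ∀ i x, |h i x| ≤ 1)
    {M : List Constraint → ℝ} (hM : IsComputableFamily M)
    (hle : ∀ s x, M s ≤ penalty h s x) (hex : ∀ s, ∃ x, penalty h s x = M s) :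
    ∃ (pt : ℕ → X) (code : ℕ → ℕ → ℕ), Computable₂ code ∧
      (∀ n m, penalty h (gridCell (m + 1) (code n m)) (pt n) ≤ 1) ∧
      ∀ k t x, penalty h (gridCell k t) x ≤ (2 : ℝ)⁻¹ ^ (k + 3) →
        penalty h (gridCell k t) (pt (Nat.pair k t)) ≤ 1 := by
  obtain ⟨q, hq, hqM⟩ := hM
  have htest := computable_approxTest hq
  -- The disjunction makes the search total: it stops at once on lists that fail the test.
  have hsearch : Computable₂ fun (a : List Constraint × ℕ) (r : ℕ) =>
      !(approxTest q a.1 a.2) || approxTest q (a.1 ++ gridCell (a.2 + 1) r) (a.2 + 1) := by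
    have hj : Computable fun x : (List Constraint × ℕ) × ℕ => x.1.2 + 1 :=
      Computable.succ.comp (Computable.snd.comp .fst)
    exact Primrec.or.to_comp.comp (Primrec.not.to_comp.comp (htest.comp (Computable.fst.comp .fst)
      (Computable.snd.comp .fst))) (htest.comp (Computable.list_append.comp
        (Computable.fst.comp .fst) (primrec_gridCell.to_comp.comp hj .snd)) hj)
  obtain ⟨next, hnext, hnext_spec⟩ := exists_computable_choice hsearch fun a => by
    cases ha : approxTest q a.1 a.2 with
    | false => exact ⟨0, by simp⟩
    | true => simpa using exists_approxTest_append hb hqM hle hex ha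
  -- The index `n` encodes a level and a cell. A cell that fails the test is replaced by the empty
  -- list, so every `n` names a point.
  let init : ℕ → List Constraint := fun n =>
    bif approxTest q (gridCell n.unpair.1 n.unpair.2) 0 then gridCell n.unpair.1 n.unpair.2 else []
  let seq : ℕ → ℕ → List Constraint := fun n m => Nat.rec (init n)
    (fun m s => s ++ gridCell (m + 1) (next (s, m))) m
  have hcell : Computable fun n : ℕ => gridCell n.unpair.1 n.unpair.2 :=
    primrec_gridCell.to_comp.comp (Computable.fst.comp .unpair) (Computable.snd.comp .unpair)
  have hinit : Computable init :=
    Computable.cond (htest.comp hcell (.const 0)) hcell (.const [])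
  have hseq : Computable₂ seq := by
    refine Computable.nat_rec (f := fun x : ℕ × ℕ => x.2) (g := fun x => init x.1)
      (h := fun _ ms => ms.2 ++ gridCell (ms.1 + 1) (next (ms.2, ms.1))) .snd
      (hinit.comp .fst) ?_
    have hm : Computable fun x : (ℕ × ℕ) × ℕ × List Constraint => x.2.1 :=
      Computable.fst.comp .snd
    have hs : Computable fun x : (ℕ × ℕ) × ℕ × List Constraint => x.2.2 :=
      Computable.snd.comp .snd
    exact Computable.list_append.comp hs (primrec_gridCell.to_comp.comp (Computable.succ.comp hm)
      (hnext.comp (Computable.pair hs hm)))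
  have hnil : approxTest q [] 0 = true := by
    refine approxTest_of_le hqM ?_
    obtain ⟨x, hx⟩ := hex []
    rw [penalty_nil] at hx
    rw [← hx]; norm_num
  have hseq_test : ∀ n m, approxTest q (seq n m) m = true := by
    intro n m
    induction m with
    | zero =>
      change approxTest q (init n) 0 = true
      simp only [init]
      cases hi : approxTest q (gridCell n.unpair.1 n.unpair.2) 0 with
      | true => simpa using hi
      | false => simpa using hnil
    | succ m ih =>
      have := hnext_spec (seq n m, m)
      rw [ih] at this
      simpa using this
  -- The sublevel sets are closed, nonempty by the test, and decreasing because penalties are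
  -- nonnegative; compactness gives a common point.
  have hpt : ∀ n, ∃ x, ∀ m, penalty h (seq n m) x ≤ 1 := by
    intro n
    have hcl : ∀ m, IsClosed {x | penalty h (seq n m) x ≤ 1} := fun m =>
      isClosed_le (continuous_penalty h hc _) continuous_const
    obtain ⟨x, hx⟩ := IsCompact.nonempty_iInter_of_sequence_nonempty_isCompact_isClosed
      (fun m => {x | penalty h (seq n m) x ≤ 1})
      (fun m x hx => by
        have hx' : penalty h (seq n m ++ gridCell (m + 1) (next (seq n m, m))) x ≤ 1 := hx
        rw [penalty_append] at hx'
        have := penalty_nonneg h (gridCell (m + 1) (next (seq n m, m))) x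
        exact (by linarith : penalty h (seq n m) x ≤ 1))
      (fun m => by
        obtain ⟨x, hx⟩ := hex (seq n m)
        refine ⟨x, ?_⟩
        have := lt_one_of_approxTest hqM (hseq_test n m)
        rw [Set.mem_ofPred_eq, hx]
        have hp : (0 : ℝ) < 2⁻¹ ^ m := by positivity
        simp only [pow_succ] at this
        linarith)
      (hcl 0).isCompact hcl
    exact ⟨x, fun m => Set.mem_iInter.1 hx m⟩
  choose pt hpt using hpt
  refine ⟨pt, fun n m => next (seq n m, m), hnext.comp (Computable.pair hseq .snd),
    fun n m => ?_, fun k t x hx => ?_⟩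
  · have := hpt n (m + 1)
    change penalty h (seq n m ++ gridCell (m + 1) (next (seq n m, m))) (pt n) ≤ 1 at this
    rw [penalty_append] at this
    have := penalty_nonneg h (seq n m) (pt n)
    linarith
  · have h0 := hpt (Nat.pair k t) 0
    -- A cell close to `x` has least penalty at most 1/8, well below the initial threshold 1/2, so
    -- the fallback is not used.
    have ht : approxTest q (gridCell k t) 0 = true := by
      refine approxTest_of_le hqM ?_
      have h1 := (hle (gridCell k t) x).trans hx
      have h2 : (2 : ℝ)⁻¹ ^ (k + 3) ≤ 2⁻¹ ^ 3 :=
        pow_le_pow_of_le_one (by norm_num) (by norm_num) (by omega)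
      norm_num at *
      linarith
    have : seq (Nat.pair k t) 0 = gridCell k t := by
      change init _ = _
      simp [init, ht]
    rwa [this] at h0

end Points

/-! ### Distances from grid codes -/

theorem nat_dist_cast (a b : ℕ) : (((a - b) + (b - a) : ℕ) : ℝ) = |(a : ℝ) - b| := by
  rcases le_total a b with h | h
  · have h' : (a : ℝ) ≤ b := by exact_mod_cast h
    rw [Nat.sub_eq_zero_of_le h, zero_add, Nat.cast_sub h, abs_sub_comm, abs_of_nonneg (by linarith)]
  · have h' : (b : ℝ) ≤ a := by exact_mod_cast h
    rw [Nat.sub_eq_zero_of_le h, add_zero, Nat.cast_sub h, abs_of_nonneg (by linarith)]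

section Distance

theorem summable_min_dist (x y : ℕ → ℝ) :
    Summable fun i => min ((2 : ℝ)⁻¹ ^ i) |x i - y i| := by
  refine .of_nonneg_of_le (fun i => by positivity) (fun i => min_le_left _ _) ?_
  exact summable_geometric_of_lt_one (by norm_num) (by norm_num)

theorem abs_sum_sub_tsum_min_dist_le (x y : ℕ → ℝ) (N : ℕ) :
    abs (∑ i ∈ Finset.range N, min ((2 : ℝ)⁻¹ ^ i) |x i - y i| -
      ∑' i, min ((2 : ℝ)⁻¹ ^ i) |x i - y i|) ≤ 2 * (2 : ℝ)⁻¹ ^ N := by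
  have hs := summable_min_dist x y
  rw [← hs.sum_add_tsum_nat_add N, sub_add_cancel_left, abs_neg,
    abs_of_nonneg (tsum_nonneg fun i => by positivity)]
  have hg : Summable fun i : ℕ => (2 : ℝ)⁻¹ ^ (i + N) :=
    (summable_nat_add_iff N).2 (summable_geometric_of_lt_one (by norm_num) (by norm_num))
  refine (((summable_nat_add_iff N).2 hs).tsum_le_tsum (fun i => min_le_left _ _) hg).trans_eq ?_
  simp only [pow_add]
  rw [tsum_mul_right, tsum_geometric_of_lt_one (by norm_num) (by norm_num)]
  norm_num

/-- A natural number `S` such that `S / gridScale l` approximates the distance of the points whose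
grid codes of level `l` are `r` and `s`, up to the coordinates from `N` on. -/
def gridDist (l N r s : ℕ) : ℕ :=
  ((List.range N).map fun i => min (gridScale l / 2 ^ i)
    ((gridDigit l r i - gridDigit l s i) + (gridDigit l s i - gridDigit l r i))).sum

theorem gridDist_div (l N r s : ℕ) (hN : N ≤ l) : (gridDist l N r s : ℝ) / gridScale l =
    ∑ i ∈ Finset.range N, min ((2 : ℝ)⁻¹ ^ i)
      |((gridDigit l r i : ℝ) - gridScale l) / gridScale l -
        ((gridDigit l s i : ℝ) - gridScale l) / gridScale l| := by
  have hD : (0 : ℝ) < gridScale l := by exact_mod_cast gridScale_pos l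
  rw [gridDist, ← List.sum_toFinset _ List.nodup_range, List.toFinset_range, Nat.cast_sum,
    Finset.sum_div]
  refine Finset.sum_congr rfl fun i hi => ?_
  have hi' : i < N := Finset.mem_range.1 hi
  -- The division of natural numbers in `gridDist` is exact here, since `i < N ≤ l`.
  have hdvd : 2 ^ i ∣ gridScale l := pow_dvd_pow 2 (by omega)
  rw [Nat.cast_min, nat_dist_cast, Nat.cast_div hdvd (by positivity), ← min_div_div_right hD.le]
  congr 1
  · push_cast
    rw [inv_pow, div_right_comm, div_self hD.ne', one_div]
  · rw [← sub_div, sub_sub_sub_cancel_right, abs_div, abs_of_pos hD]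

/-- The first `N` terms are each off by at most 2^-l, because the minimum with a constant is
1-Lipschitz and both points are within 2^-(l+1) of their grid points; the tail is bounded by a
geometric series. -/
theorem abs_gridDist_sub_le {X : Type*} {h : ℕ → X → ℝ} {l N r s : ℕ} {x y : X} (hN : N ≤ l)
    (hx : penalty h (gridCell l r) x ≤ 1) (hy : penalty h (gridCell l s) y ≤ 1) :
    abs ((gridDist l N r s : ℝ) / gridScale l - ∑' i, min ((2 : ℝ)⁻¹ ^ i) |h i x - h i y|) ≤
      N * (2 : ℝ)⁻¹ ^ l + 2 * (2 : ℝ)⁻¹ ^ N := by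
  rw [gridDist_div l N r s hN]
  refine (abs_sub_le _ (∑ i ∈ Finset.range N, min ((2 : ℝ)⁻¹ ^ i) |h i x - h i y|) _).trans ?_
  refine add_le_add ?_ (abs_sum_sub_tsum_min_dist_le (fun i => h i x) (fun i => h i y) N)
  rw [← Finset.sum_sub_distrib]
  refine (Finset.abs_sum_le_sum_abs _ _).trans ?_
  refine (Finset.sum_le_card_nsmul _ _ ((2 : ℝ)⁻¹ ^ l) fun i hi => ?_).trans_eq (by simp)
  have hi' : i < l := (Finset.mem_range.1 hi).trans_le hN
  have h1 := abs_sub_le_of_penalty_le_one h hx hi'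
  have h2 := abs_sub_le_of_penalty_le_one h hy hi'
  refine (abs_min_sub_min_le_max _ _ _ _).trans ?_
  rw [sub_self, abs_zero, max_eq_right (abs_nonneg _)]
  refine (abs_abs_sub_abs_le _ _).trans ?_
  rw [pow_succ] at h1 h2
  rw [abs_le] at *
  constructor <;> linarith [h1.1, h1.2, h2.1, h2.2]

theorem tsum_min_dist_le {X : Type*} {h : ℕ → X → ℝ} {l r : ℕ} {x y : X}
    (hx : penalty h (gridCell l r) x ≤ 1) (hy : penalty h (gridCell l r) y ≤ 1) :
    ∑' i, min ((2 : ℝ)⁻¹ ^ i) |h i x - h i y| ≤ (l + 2) * (2 : ℝ)⁻¹ ^ l := by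
  have h0 : gridDist l l r r = 0 := by simp [gridDist]
  have := (abs_le.1 (abs_gridDist_sub_le le_rfl hx hy)).1
  rw [h0] at this
  simp only [Nat.cast_zero, zero_div] at this
  linarith

theorem computable_gridDist {α : Type*} [Primcodable α] {f g r s : α → ℕ} (hf : Computable f)
    (hg : Computable g) (hr : Computable r) (hs : Computable s) :
    Computable fun a => gridDist (f a) (g a) (r a) (s a) := by
  refine computable_list_sum (computable_list_map (Primrec.list_range.to_comp.comp hg)
    (g := fun a i => min (gridScale (f a) / 2 ^ i)
      ((gridDigit (f a) (r a) i - gridDigit (f a) (s a) i) +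
        (gridDigit (f a) (s a) i - gridDigit (f a) (r a) i))) ?_)
  have hd : Primrec fun x : ℕ × ℕ × ℕ => gridDigit x.1 x.2.1 x.2.2 :=
    primrec_gridDigit .fst (Primrec.fst.comp .snd) (Primrec.snd.comp .snd)
  have hA : Computable fun x : α × ℕ => gridDigit (f x.1) (r x.1) x.2 :=
    hd.to_comp.comp (Computable.pair (hf.comp .fst) (Computable.pair (hr.comp .fst) .snd))
  have hB : Computable fun x : α × ℕ => gridDigit (f x.1) (s x.1) x.2 :=
    hd.to_comp.comp (Computable.pair (hf.comp .fst) (Computable.pair (hs.comp .fst) .snd))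
  have hD : Computable fun x : α × ℕ => gridScale (f x.1) / 2 ^ x.2 :=
    Primrec.nat_div.to_comp.comp (primrec_gridScale.to_comp.comp (hf.comp .fst))
      (primrec_nat_pow.to_comp.comp (.const 2) .snd)
  exact Primrec.nat_min.to_comp.comp hD (Primrec.nat_add.to_comp.comp
    (Primrec.nat_sub.to_comp.comp hA hB) (Primrec.nat_sub.to_comp.comp hB hA))

end Distance

/-! ### From computable least penalties to a computably compact presentation -/

section Presentation

variable {X : Type*} [TopologicalSpace X] [CompactSpace X] {h : ℕ → X → ℝ}

/-- A continuous injection of a compact space into ℕ → ℝ is an embedding, so the product metric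
pulls back to a compatible one. -/
theorem exists_metricSpace_dist_eq_tsum (hc : ∀ i, Continuous (h i))
    (hsep : ∀ x y, (∀ i, h i x = h i y) → x = y) :
    ∃ m : MetricSpace X, m.toUniformSpace.toTopologicalSpace = ‹TopologicalSpace X› ∧
      ∀ x y, m.dist x y = ∑' i, min ((2 : ℝ)⁻¹ ^ i) |h i x - h i y| := by
  have hcont : Continuous fun x i => h i x := continuous_pi hc
  have hemb : Topology.IsEmbedding fun (x : X) (i : ℕ) => h i x :=
    (hcont.isClosedEmbedding fun x y hxy => hsep x y (congrFun hxy)).isEmbedding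
  exact ⟨@Topology.IsEmbedding.comapMetricSpace X (ℕ → ℝ) _ PiCountable.metricSpace
    (fun x i => h i x) hemb, rfl, fun x y => rfl⟩

theorem hasComputablyCompactPresentation_of_penalty (hc : ∀ i, Continuous (h i))
    (hb : ∀ i x, |h i x| ≤ 1) (hsep : ∀ x y, (∀ i, h i x = h i y) → x = y)
    {M : List Constraint → ℝ} (hM : IsComputableFamily M)
    (hle : ∀ s x, M s ≤ penalty h s x) (hex : ∀ s, ∃ x, penalty h s x = M s) :
    HasComputablyCompactPresentation X := by
  obtain ⟨pt, code, hcode, hpt, hcell⟩ := exists_computable_points hc hb hM hle hex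
  obtain ⟨m, hm, hdist⟩ := exists_metricSpace_dist_eq_tsum hc hsep
  -- Points in a common cell of level L are at distance at most (L + 2) 2^-L, which is below 2^-k
  -- for this L.
  let L : ℕ → ℕ := fun k => 2 * k + 4
  let cover : ℕ → List ℕ := fun k =>
    (List.range ((2 * gridScale (L k) + 1) ^ L k)).map fun t => Nat.pair (L k) t
  have hcover : ∀ k x, ∃ n ∈ cover k, m.dist x (pt n) < (2 : ℝ)⁻¹ ^ k := by
    intro k x
    obtain ⟨t, ht, hx⟩ := exists_gridCell h hb (L k) x
    refine ⟨Nat.pair (L k) t, List.mem_map.2 ⟨t, List.mem_range.2 ht, rfl⟩, ?_⟩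
    rw [hdist]
    refine (tsum_min_dist_le (hx.trans (pow_le_one₀ (by norm_num) (by norm_num)))
      (hcell _ _ x hx)).trans_lt ?_
    have hk : (k : ℝ) + 1 ≤ 2 ^ k := by exact_mod_cast Nat.lt_two_pow_self
    have hp : (0 : ℝ) < 2 ^ k := by positivity
    simp only [L, pow_add, pow_mul, inv_pow]
    push_cast
    rw [show ((2 : ℝ) ^ 2) ^ k = 2 ^ k * 2 ^ k by rw [← mul_pow]; norm_num]
    generalize (2 : ℝ) ^ k = p at *
    rw [show (2 * (k : ℝ) + 4 + 2) * ((p * p)⁻¹ * (2 ^ 4)⁻¹) = (2 * k + 6) / 16 / p * p⁻¹ by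
      field_simp; ring]
    refine mul_lt_of_lt_one_left (inv_pos.2 hp) ?_
    rw [div_lt_one hp]
    linarith
  have hcoverc : Computable cover := by
    have hL : Primrec L := Primrec.nat_add.comp (Primrec.nat_mul.comp (.const 2) .id) (.const 4)
    refine (Primrec.list_map (Primrec.list_range.comp (primrec_nat_pow.comp (Primrec.succ.comp
      (Primrec.nat_mul.comp (.const 2) (primrec_gridScale.comp hL))) hL)) ?_).to_comp
    exact Primrec₂.natPair.comp (hL.comp .fst) .snd
  -- `code n (2 * k + 3)` is a cell of level 2k + 4. With N = k + 2 the error is at most (k+2)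
  -- 2^-(2k+4) + 2^-(k+1) < 2^-k.
  refine ⟨⟨m, hm, ?_, pt, ?_⟩, ⟨fun mn k => (gridDist (2 * k + 3 + 1) (k + 2)
    (code mn.1 (2 * k + 3)) (code mn.2 (2 * k + 3)), 0, gridScale (2 * k + 3 + 1) - 1), ?_, ?_⟩, cover, hcoverc, hcover⟩
  · subst hm
    exact complete_of_compact
  · subst hm
    refine Metric.denseRange_iff.2 fun x r hr => ?_
    obtain ⟨k, hk⟩ := exists_pow_lt_of_lt_one hr (by norm_num : (2 : ℝ)⁻¹ < 1)
    obtain ⟨n, -, hn⟩ := hcover k x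
    exact ⟨n, hn.trans hk⟩
  · have hN : Computable fun x : (ℕ × ℕ) × ℕ => x.2 + 2 :=
      Primrec.nat_add.to_comp.comp .snd (.const 2)
    have hl : Computable fun x : (ℕ × ℕ) × ℕ => 2 * x.2 + 3 :=
      Primrec.nat_add.to_comp.comp (Primrec.nat_mul.to_comp.comp (.const 2) .snd) (.const 3)
    have hl' := Computable.succ.comp hl
    exact Computable.pair (computable_gridDist hl' hN
      (hcode.comp (Computable.fst.comp .fst) hl) (hcode.comp (Computable.snd.comp .fst) hl))
      (Computable.pair (.const 0) (Computable.pred.comp (primrec_gridScale.to_comp.comp hl')))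
  · rintro ⟨n₁, n₂⟩ k
    have h1 : 1 ≤ gridScale (2 * k + 3 + 1) := gridScale_pos _
    have h2 := abs_gridDist_sub_le (N := k + 2) (by omega) (hpt n₁ (2 * k + 3))
      (hpt n₂ (2 * k + 3))
    rw [← hdist] at h2
    simp only [RatCode.toRat]
    push_cast [Nat.cast_sub h1]
    rw [sub_zero, sub_add_cancel]
    refine h2.trans_lt ?_
    have hk : (k : ℝ) + 1 ≤ 2 ^ k := by exact_mod_cast Nat.lt_two_pow_self
    have hp : (0 : ℝ) < 2 ^ k := by positivity
    simp only [pow_add, pow_mul, inv_pow]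
    push_cast
    rw [show ((2 : ℝ) ^ 2) ^ k = 2 ^ k * 2 ^ k by rw [← mul_pow]; norm_num]
    generalize (2 : ℝ) ^ k = p at *
    rw [show ((k : ℝ) + 2) * ((p * p)⁻¹ * (2 ^ 3)⁻¹ * (2 ^ 1)⁻¹) + 2 * (p⁻¹ * (2 ^ 2)⁻¹) =
      ((k + 2) / 16 / p + 1 / 2) * p⁻¹ by field_simp; ring]
    refine mul_lt_of_lt_one_left (inv_pos.2 hp) ?_
    have : ((k : ℝ) + 2) / 16 / p < 1 / 2 := by
      rw [div_lt_iff₀ hp]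
      linarith
    linarith

end Presentation

/-! ### Arithmetic of rational codes and of rational `*`-polynomials -/

namespace RatCode

/-- The code of a natural number. -/
def ofNat (n : ℕ) : RatCode := (n, 0, 0)

/-- Addition of codes of rational numbers. -/
def add (q r : RatCode) : RatCode :=
  (q.1 * (r.2.2 + 1) + r.1 * (q.2.2 + 1), q.2.1 * (r.2.2 + 1) + r.2.1 * (q.2.2 + 1),
    (q.2.2 + 1) * (r.2.2 + 1) - 1)

/-- Multiplication of codes of rational numbers. -/
def mul (q r : RatCode) : RatCode :=
  (q.1 * r.1 + q.2.1 * r.2.1, q.1 * r.2.1 + q.2.1 * r.1, (q.2.2 + 1) * (r.2.2 + 1) - 1)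

/-- Negation of codes of rational numbers. -/
def neg (q : RatCode) : RatCode := (q.2.1, q.1, q.2.2)

theorem toRat_ofNat (n : ℕ) : (ofNat n).toRat = n := by simp [ofNat, toRat]

theorem cast_pred_mul_succ (c d : ℕ) :
    (((c + 1) * (d + 1) - 1 : ℕ) : ℚ) + 1 = ((c : ℚ) + 1) * (d + 1) := by
  have : (c + 1) * (d + 1) - 1 + 1 = (c + 1) * (d + 1) := Nat.sub_add_cancel (by nlinarith)
  exact_mod_cast this

theorem toRat_add (q r : RatCode) : (add q r).toRat = q.toRat + r.toRat := by
  have h1 : ((q.2.2 : ℚ) + 1) ≠ 0 := by positivity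
  have h2 : ((r.2.2 : ℚ) + 1) ≠ 0 := by positivity
  simp only [add, toRat, cast_pred_mul_succ]
  push_cast
  field_simp
  ring

theorem toRat_mul (q r : RatCode) : (mul q r).toRat = q.toRat * r.toRat := by
  have h1 : ((q.2.2 : ℚ) + 1) ≠ 0 := by positivity
  have h2 : ((r.2.2 : ℚ) + 1) ≠ 0 := by positivity
  simp only [mul, toRat, cast_pred_mul_succ]
  push_cast
  field_simp
  ring

theorem toRat_neg (q : RatCode) : (neg q).toRat = -q.toRat := by
  simp only [neg, toRat]
  rw [← neg_div, neg_sub]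

theorem toRat_surjective : Function.Surjective toRat := fun q => by
  refine ⟨(q.num.toNat, (-q.num).toNat, q.den - 1), ?_⟩
  have h1 : ((q.num.toNat : ℤ) : ℚ) - (((-q.num).toNat : ℤ) : ℚ) = q.num := by
    rw [← Int.cast_sub, Int.toNat_sub_toNat_neg]
  simp only [toRat]
  rw [Nat.cast_sub q.pos, Nat.cast_one, sub_add_cancel]
  rw [Int.cast_natCast, Int.cast_natCast] at h1
  rw [h1, Rat.num_div_den]

/-- The denominator is at least 1. This gives natural number bounds that are read off from the code.
-/
theorem abs_toRat_le (q : RatCode) : |((q.toRat : ℚ) : ℝ)| ≤ q.1 + q.2.1 := by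
  simp only [toRat]
  push_cast
  rw [abs_div, abs_of_pos (by positivity : (0 : ℝ) < (q.2.2 : ℝ) + 1)]
  refine div_le_of_le_mul₀ (by positivity) (by positivity) ?_
  have h1 : (0 : ℝ) ≤ q.1 := by positivity
  have h2 : (0 : ℝ) ≤ q.2.1 := by positivity
  have h3 : (0 : ℝ) ≤ q.2.2 := by positivity
  refine abs_le.2 ⟨?_, ?_⟩ <;> nlinarith

theorem primrec_ofNat : Primrec ofNat := Primrec.pair .id (.const (0, 0))

theorem primrec_pred_mul_succ : Primrec fun x : RatCode × RatCode =>
    (x.1.2.2 + 1) * (x.2.2.2 + 1) - 1 := by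
  have h1 : Primrec fun x : RatCode × RatCode => x.1.2.2 + 1 :=
    Primrec.succ.comp (Primrec.snd.comp (Primrec.snd.comp .fst))
  have h2 : Primrec fun x : RatCode × RatCode => x.2.2.2 + 1 :=
    Primrec.succ.comp (Primrec.snd.comp (Primrec.snd.comp .snd))
  exact Primrec.pred.comp (Primrec.nat_mul.comp h1 h2)

theorem primrec_add : Primrec₂ add := by
  have a1 : Primrec fun x : RatCode × RatCode => x.1.1 := Primrec.fst.comp .fst
  have a2 : Primrec fun x : RatCode × RatCode => x.2.1 := Primrec.fst.comp .snd
  have b1 : Primrec fun x : RatCode × RatCode => x.1.2.1 := Primrec.fst.comp (Primrec.snd.comp .fst)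
  have b2 : Primrec fun x : RatCode × RatCode => x.2.2.1 := Primrec.fst.comp (Primrec.snd.comp .snd)
  have c1 : Primrec fun x : RatCode × RatCode => x.1.2.2 + 1 :=
    Primrec.succ.comp (Primrec.snd.comp (Primrec.snd.comp .fst))
  have c2 : Primrec fun x : RatCode × RatCode => x.2.2.2 + 1 :=
    Primrec.succ.comp (Primrec.snd.comp (Primrec.snd.comp .snd))
  exact Primrec.pair
    (Primrec.nat_add.comp (Primrec.nat_mul.comp a1 c2) (Primrec.nat_mul.comp a2 c1))
    (Primrec.pair (Primrec.nat_add.comp (Primrec.nat_mul.comp b1 c2) (Primrec.nat_mul.comp b2 c1))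
      primrec_pred_mul_succ)

theorem primrec_mul : Primrec₂ mul := by
  have a1 : Primrec fun x : RatCode × RatCode => x.1.1 := Primrec.fst.comp .fst
  have a2 : Primrec fun x : RatCode × RatCode => x.2.1 := Primrec.fst.comp .snd
  have b1 : Primrec fun x : RatCode × RatCode => x.1.2.1 := Primrec.fst.comp (Primrec.snd.comp .fst)
  have b2 : Primrec fun x : RatCode × RatCode => x.2.2.1 := Primrec.fst.comp (Primrec.snd.comp .snd)
  exact Primrec.pair
    (Primrec.nat_add.comp (Primrec.nat_mul.comp a1 a2) (Primrec.nat_mul.comp b1 b2))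
    (Primrec.pair (Primrec.nat_add.comp (Primrec.nat_mul.comp a1 b2) (Primrec.nat_mul.comp b1 a2))
      primrec_pred_mul_succ)

theorem primrec_neg : Primrec neg :=
  Primrec.pair (Primrec.fst.comp .snd) (Primrec.pair .fst (Primrec.snd.comp .snd))

end RatCode

/-- Multiplication of codes of elements of `ℚ(i)`. -/
def coeffMul (c d : RatCode × RatCode) : RatCode × RatCode :=
  ((c.1.mul d.1).add (c.2.mul d.2).neg, (c.1.mul d.2).add (c.2.mul d.1))

theorem evalCoeff_coeffMul (c d : RatCode × RatCode) :
    evalCoeff (coeffMul c d) = evalCoeff c * evalCoeff d := by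
  simp only [evalCoeff, coeffMul, RatCode.toRat_add, RatCode.toRat_mul, RatCode.toRat_neg]
  push_cast
  linear_combination (-(c.2.toRat : ℂ) * (d.2.toRat : ℂ)) * Complex.I_mul_I

theorem primrec_coeffMul : Primrec₂ coeffMul := by
  have a1 : Primrec fun x : (RatCode × RatCode) × RatCode × RatCode => x.1.1 := Primrec.fst.comp .fst
  have a2 : Primrec fun x : (RatCode × RatCode) × RatCode × RatCode => x.2.1 := Primrec.fst.comp .snd
  have b1 : Primrec fun x : (RatCode × RatCode) × RatCode × RatCode => x.1.2 := Primrec.snd.comp .fst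
  have b2 : Primrec fun x : (RatCode × RatCode) × RatCode × RatCode => x.2.2 := Primrec.snd.comp .snd
  have hm := RatCode.primrec_mul
  exact Primrec.pair
    (RatCode.primrec_add.comp (hm.comp a1 a2) (RatCode.primrec_neg.comp (hm.comp b1 b2)))
    (RatCode.primrec_add.comp (hm.comp a1 b2) (hm.comp b1 a2))

theorem denseRange_evalCoeff : DenseRange evalCoeff := by
  have h1 : DenseRange fun q : RatCode => ((q.toRat : ℚ) : ℝ) :=
    Rat.denseRange_cast.comp RatCode.toRat_surjective.denseRange Rat.continuous_coe_real
  have h2 := (Complex.equivRealProdCLM.symm.surjective.denseRange).comp (h1.prodMap h1)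
    Complex.equivRealProdCLM.symm.continuous
  convert h2 using 1
  ext c : 1
  refine Eq.trans ?_ (Complex.equivRealProdCLM_symm_apply
    (((c.1.toRat : ℚ) : ℝ), ((c.2.toRat : ℚ) : ℝ))).symm
  simp [evalCoeff]

namespace RatStarPoly

/-- Multiplication of terms of rational `*`-polynomials. -/
def termMul (s t : (RatCode × RatCode) × Word) : (RatCode × RatCode) × Word :=
  (coeffMul s.1 t.1, (s.2.1, s.2.2 ++ t.2.1 :: t.2.2))

/-- Multiplication of rational `*`-polynomials. -/
def mul (p q : RatStarPoly) : RatStarPoly := p.flatMap fun s => q.map (termMul s)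

/-- Multiplication of a rational `*`-polynomial by a rational number. -/
def smul (c : RatCode) (p : RatStarPoly) : RatStarPoly :=
  p.map fun t => (coeffMul (c, RatCode.ofNat 0) t.1, t.2)

theorem primrec_termMul : Primrec₂ termMul := by
  have h1 : Primrec fun y : ((RatCode × RatCode) × Word) × (RatCode × RatCode) × Word =>
      coeffMul y.1.1 y.2.1 := primrec_coeffMul.comp (Primrec.fst.comp .fst) (Primrec.fst.comp .snd)
  have h2 : Primrec fun y : ((RatCode × RatCode) × Word) × (RatCode × RatCode) × Word =>
      y.1.2.1 := Primrec.fst.comp (Primrec.snd.comp .fst)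
  have h3 : Primrec fun y : ((RatCode × RatCode) × Word) × (RatCode × RatCode) × Word =>
      y.1.2.2 := Primrec.snd.comp (Primrec.snd.comp .fst)
  have h4 : Primrec fun y : ((RatCode × RatCode) × Word) × (RatCode × RatCode) × Word =>
      y.2.2.1 := Primrec.fst.comp (Primrec.snd.comp .snd)
  have h5 : Primrec fun y : ((RatCode × RatCode) × Word) × (RatCode × RatCode) × Word =>
      y.2.2.2 := Primrec.snd.comp (Primrec.snd.comp .snd)
  have h6 := Primrec.list_append.comp h3 (Primrec.list_cons.comp h4 h5)
  exact Primrec.pair h1 (Primrec.pair h2 h6)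

theorem primrec_mul : Primrec₂ mul :=
  Primrec.list_flatMap .fst (Primrec.list_map (Primrec.snd.comp .fst)
    (primrec_termMul.comp (Primrec.snd.comp .fst) .snd).to₂).to₂

theorem primrec_smul : Primrec₂ smul := by
  refine Primrec.list_map .snd (g := fun (x : RatCode × RatStarPoly) t =>
    (coeffMul (x.1, RatCode.ofNat 0) t.1, t.2)) ?_
  exact Primrec.pair (primrec_coeffMul.comp (Primrec.pair (Primrec.fst.comp .fst)
    (.const (RatCode.ofNat 0))) (Primrec.fst.comp .snd)) (Primrec.snd.comp .snd)

section Eval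

variable {A : Type*} [NonUnitalCStarAlgebra A] (v : ℕ → A)

theorem evalWord_append (w w' : Word) :
    evalWord v (w.1, w.2 ++ w'.1 :: w'.2) = evalWord v w * evalWord v w' := by
  have aux : ∀ (l : List Letter) (a b : A), l.foldl (fun a l => a * evalLetter v l) (a * b) =
      a * l.foldl (fun a l => a * evalLetter v l) b := by
    intro l
    induction l with
    | nil => intro a b; rfl
    | cons x l ih => intro a b; simp only [List.foldl_cons, mul_assoc, ih]
  simp only [evalWord, List.foldl_append, List.foldl_cons, aux]

theorem evalPoly_nil : evalPoly v [] = 0 := rfl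

theorem evalPoly_cons (t : (RatCode × RatCode) × Word) (p : RatStarPoly) :
    evalPoly v (t :: p) = evalCoeff t.1 • evalWord v t.2 + evalPoly v p := by
  simp [evalPoly]

theorem evalPoly_append (p q : RatStarPoly) :
    evalPoly v (p ++ q) = evalPoly v p + evalPoly v q := by
  simp [evalPoly]

theorem evalPoly_mul (p q : RatStarPoly) :
    evalPoly v (mul p q) = evalPoly v p * evalPoly v q := by
  induction p with
  | nil => simp [mul, evalPoly_nil]
  | cons s p ih =>
    have h1 : mul (s :: p) q =
        q.map (termMul s) ++ mul p q := rfl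
    rw [h1, evalPoly_append, ih, evalPoly_cons, add_mul]
    congr 1
    clear h1 ih
    induction q with
    | nil => simp [evalPoly_nil]
    | cons t q ih =>
      rw [List.map_cons, evalPoly_cons, ih, evalPoly_cons, mul_add, termMul, evalCoeff_coeffMul,
        evalWord_append, smul_mul_smul_comm]

theorem evalPoly_map_coeffMul (c : RatCode × RatCode) (p : RatStarPoly) :
    evalPoly v (p.map fun t => (coeffMul c t.1, t.2)) = evalCoeff c • evalPoly v p := by
  induction p with
  | nil => simp [evalPoly_nil]
  | cons t p ih =>
    rw [List.map_cons, evalPoly_cons, ih, evalPoly_cons, smul_add, evalCoeff_coeffMul, mul_smul]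

theorem evalPoly_smul (c : RatCode) (p : RatStarPoly) :
    evalPoly v (smul c p) = (c.toRat : ℂ) • evalPoly v p := by
  rw [smul, evalPoly_map_coeffMul]
  simp [evalCoeff, RatCode.toRat_ofNat]

end Eval

end RatStarPoly

/-- The closure of the rational vectors contains the generators and their adjoints and is stable
under sums, products and, as ℚ(i) is dense in ℂ, complex scalars. -/
theorem CStarPresentation.denseRange_rationalVector {A : Type*} [NonUnitalCStarAlgebra A]
    (P : CStarPresentation A) : DenseRange P.rationalVector := by
  have hle : (NonUnitalStarAlgebra.adjoin ℂ (Set.range P.gen) : Set A) ⊆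
      closure (Set.range P.rationalVector) := by
    intro a ha
    have ha' : a ∈ NonUnitalAlgebra.adjoin ℂ (Set.range P.gen ∪ star (Set.range P.gen)) := ha
    have hone : evalCoeff (RatCode.ofNat 1, RatCode.ofNat 0) = 1 := by
      simp [evalCoeff, RatCode.toRat_ofNat]
    induction ha' using NonUnitalAlgebra.adjoin_induction with
    | mem x hx =>
      apply subset_closure
      rcases hx with ⟨n, rfl⟩ | ⟨n, hn⟩
      · refine ⟨[((RatCode.ofNat 1, RatCode.ofNat 0), ((n, false), []))], ?_⟩
        simp [CStarPresentation.rationalVector, evalPoly, hone, evalWord, evalLetter]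
      · refine ⟨[((RatCode.ofNat 1, RatCode.ofNat 0), ((n, true), []))], ?_⟩
        simp [CStarPresentation.rationalVector, evalPoly, hone, evalWord, evalLetter, hn]
    | add x y hx hy ihx ihy =>
      refine map_mem_closure₂ continuous_add (ihx hx) (ihy hy) ?_
      rintro _ ⟨p, rfl⟩ _ ⟨q, rfl⟩
      exact ⟨p ++ q, RatStarPoly.evalPoly_append _ _ _⟩
    | zero => exact subset_closure ⟨[], rfl⟩
    | mul x y hx hy ihx ihy =>
      refine map_mem_closure₂ continuous_mul (ihx hx) (ihy hy) ?_
      rintro _ ⟨p, rfl⟩ _ ⟨q, rfl⟩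
      exact ⟨p.mul q, RatStarPoly.evalPoly_mul _ _ _⟩
    | smul r x hx ihx =>
      refine map_mem_closure₂ continuous_smul (denseRange_evalCoeff r) (ihx hx) ?_
      rintro _ ⟨c, rfl⟩ _ ⟨q, rfl⟩
      exact ⟨_, RatStarPoly.evalPoly_map_coeffMul _ c q⟩
  exact dense_closure.1 (P.dense_adjoin.mono hle)

/-! ### Approximation of the unit by rational vectors -/

section Unit

variable {A : Type*} [CommCStarAlgebra A] (v : ℕ → A)

/-- Rational `*`-polynomials whose values converge to `1`, if that of `p` is close to `1`. -/
def unitApprox (p : RatStarPoly) (k : ℕ) : RatStarPoly :=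
  Nat.rec p (fun _ e => (e ++ p) ++ RatStarPoly.smul (RatCode.ofNat 1).neg (e.mul p)) k

theorem primrec_unitApprox (p : RatStarPoly) : Primrec (unitApprox p) := by
  refine Primrec.nat_rec₁ p ?_
  have he : Primrec fun x : ℕ × RatStarPoly => x.2 := .snd
  exact Primrec.list_append.comp (Primrec.list_append.comp he (.const p))
    (RatStarPoly.primrec_smul.comp (.const _) (RatStarPoly.primrec_mul.comp he (.const p)))

/-- The recursion e ↦ e + p - e p satisfies 1 - (e + p - e p) = (1 - e)(1 - p), so each step at
least halves the bound on the error. -/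
theorem norm_evalPoly_unitApprox_sub_one_le {p : RatStarPoly} (hp : ‖evalPoly v p - 1‖ ≤ 2⁻¹)
    (k : ℕ) : ‖evalPoly v (unitApprox p k) - 1‖ ≤ (2 : ℝ)⁻¹ ^ (k + 1) := by
  induction k with
  | zero => simpa [unitApprox] using hp
  | succ k ih =>
    have h1 : unitApprox p (k + 1) = (unitApprox p k ++ p) ++
      RatStarPoly.smul (RatCode.ofNat 1).neg ((unitApprox p k).mul p) := rfl
    rw [h1, RatStarPoly.evalPoly_append, RatStarPoly.evalPoly_append, RatStarPoly.evalPoly_smul,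
      RatStarPoly.evalPoly_mul, RatCode.toRat_neg, RatCode.toRat_ofNat]
    have h2 : evalPoly v (unitApprox p k) + evalPoly v p +
        ((-((1 : ℕ) : ℚ) : ℚ) : ℂ) • (evalPoly v (unitApprox p k) * evalPoly v p) - 1 =
        -((evalPoly v (unitApprox p k) - 1) * (evalPoly v p - 1)) := by
      push_cast
      rw [neg_smul, one_smul]
      ring
    rw [h2, norm_neg, pow_succ]
    exact (norm_mul_le _ _).trans (mul_le_mul ih hp (norm_nonneg _) (by positivity))

end Unit

/-! ### Self-adjoint coordinates that separate characters -/

section Coordinates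

/-- The coordinate polynomials: the real and imaginary parts of the generators, up to factors
that depend on `c`. -/
def coordPoly (c i : ℕ) : RatStarPoly :=
  [((bif i.bodd then (RatCode.ofNat 0, (1, 0, c)) else ((1, 0, c), RatCode.ofNat 0)),
      (i.div2, false), []),
    ((bif i.bodd then (RatCode.ofNat 0, (0, 1, c)) else ((1, 0, c), RatCode.ofNat 0)),
      (i.div2, true), [])]

theorem primrec_coordPoly : Primrec₂ coordPoly := by
  have hc : Primrec fun x : ℕ × ℕ => x.1 := .fst
  have hb : Primrec fun x : ℕ × ℕ => x.2.bodd := Primrec.nat_bodd.comp .snd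
  have hd : Primrec fun x : ℕ × ℕ => x.2.div2 := Primrec.nat_div2.comp .snd
  have hq : ∀ a b : ℕ, Primrec fun x : ℕ × ℕ => ((a, b, x.1) : RatCode) := fun a b =>
    Primrec.pair (.const a) (Primrec.pair (.const b) hc)
  have hcoef : ∀ a b : ℕ, Primrec fun x : ℕ × ℕ => (bif x.2.bodd then
      (RatCode.ofNat 0, ((a, b, x.1) : RatCode)) else (((1, 0, x.1) : RatCode), RatCode.ofNat 0)) :=
    fun a b => Primrec.cond hb (Primrec.pair (.const _) (hq a b))
      (Primrec.pair (hq 1 0) (.const _))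
  have hw : ∀ b : Bool, Primrec fun x : ℕ × ℕ => (((x.2.div2, b), []) : Word) := fun b =>
    Primrec.pair (Primrec.pair hd (.const b)) (.const [])
  exact Primrec.list_cons.comp (Primrec.pair (hcoef 1 0) (hw false))
    (Primrec.list_cons.comp (Primrec.pair (hcoef 0 1) (hw true)) (.const []))

variable {A : Type*} [CommCStarAlgebra A] (v : ℕ → A)

theorem evalPoly_coordPoly_even (c n : ℕ) :
    evalPoly v (coordPoly c (2 * n)) = ((c : ℂ) + 1)⁻¹ • (v n + star (v n)) := by
  have h1 : (2 * n).bodd = false := by simp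
  have h2 : (2 * n).div2 = n := by simp [Nat.div2_val]
  simp only [coordPoly, h1, h2, cond_false, RatStarPoly.evalPoly_cons, RatStarPoly.evalPoly_nil]
  simp [evalCoeff, evalWord, evalLetter, RatCode.toRat, RatCode.ofNat]

theorem evalPoly_coordPoly_odd (c n : ℕ) :
    evalPoly v (coordPoly c (2 * n + 1)) =
      (((c : ℂ) + 1)⁻¹ * Complex.I) • (v n - star (v n)) := by
  have h1 : (2 * n + 1).bodd = true := by simp
  have h2 : (2 * n + 1).div2 = n := by simp [Nat.div2_val]
  simp only [coordPoly, h1, h2, cond_true, RatStarPoly.evalPoly_cons, RatStarPoly.evalPoly_nil]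
  simp [evalCoeff, evalWord, evalLetter, RatCode.toRat, RatCode.ofNat, neg_div,
    sub_eq_add_neg]

theorem isSelfAdjoint_evalPoly_coordPoly (c i : ℕ) : IsSelfAdjoint (evalPoly v (coordPoly c i)) := by
  rcases Nat.even_or_odd' i with ⟨n, rfl | rfl⟩
  · rw [evalPoly_coordPoly_even, IsSelfAdjoint]
    simp [add_comm]
  · rw [evalPoly_coordPoly_odd, IsSelfAdjoint]
    simp only [star_smul, star_sub, star_star, star_mul', star_inv₀, star_add, star_natCast, star_one,
      Complex.star_def, Complex.conj_I]
    rw [mul_neg, neg_smul, ← smul_neg, neg_sub]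

theorem norm_evalPoly_coordPoly_le_one {c i : ℕ} (hc : 2 * ‖v i.div2‖ ≤ c + 1) :
    ‖evalPoly v (coordPoly c i)‖ ≤ 1 := by
  have hn : ‖(c : ℂ) + 1‖ = (c : ℝ) + 1 := by
    rw [← Nat.cast_succ, Complex.norm_natCast, Nat.cast_succ]
  have hpos : (0 : ℝ) < c + 1 := by positivity
  rcases Nat.even_or_odd' i with ⟨n, rfl | rfl⟩
  · rw [evalPoly_coordPoly_even, norm_smul, norm_inv, hn, inv_mul_le_one₀ hpos]
    rw [show (2 * n).div2 = n by simp [Nat.div2_val]] at hc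
    refine (norm_add_le _ _).trans ?_
    rw [norm_star]; linarith
  · rw [evalPoly_coordPoly_odd, norm_smul, norm_mul, norm_inv, hn, Complex.norm_I, mul_one,
      inv_mul_le_one₀ hpos]
    rw [show (2 * n + 1).div2 = n by simp [Nat.div2_val]] at hc
    refine (norm_sub_le _ _).trans ?_
    rw [norm_star]; linarith

/-- The coordinates 2n and 2n + 1 recover the real and imaginary parts of the value at the n-th
generator. Characters are continuous `*`-homomorphisms, hence determined by these values. -/
theorem ext_of_re_coordPoly_eq (P : CStarPresentation A) (B : ℕ → ℕ)
    (φ ψ : WeakDual.characterSpace ℂ A)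
    (h : ∀ i, (φ (evalPoly P.gen (coordPoly (B i) i))).re =
      (ψ (evalPoly P.gen (coordPoly (B i) i))).re) : φ = ψ := by
  have hre : ∀ (χ : WeakDual.characterSpace ℂ A) n,
      (χ (evalPoly P.gen (coordPoly (B (2 * n)) (2 * n)))).re =
        ((B (2 * n) : ℝ) + 1)⁻¹ * (2 * (χ (P.gen n)).re) := fun χ n => by
    rw [evalPoly_coordPoly_even, map_smul, map_add, map_star, smul_eq_mul,
      show ((B (2 * n) : ℂ) + 1)⁻¹ = (((B (2 * n) : ℝ) + 1)⁻¹ : ℝ) by push_cast; rfl,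
      Complex.re_ofReal_mul]
    simp [two_mul]
  have him : ∀ (χ : WeakDual.characterSpace ℂ A) n,
      (χ (evalPoly P.gen (coordPoly (B (2 * n + 1)) (2 * n + 1)))).re =
        ((B (2 * n + 1) : ℝ) + 1)⁻¹ * (-2 * (χ (P.gen n)).im) := fun χ n => by
    rw [evalPoly_coordPoly_odd, map_smul, map_sub, map_star, smul_eq_mul,
      show ((B (2 * n + 1) : ℂ) + 1)⁻¹ = (((B (2 * n + 1) : ℝ) + 1)⁻¹ : ℝ) by push_cast; rfl,
      mul_assoc, Complex.re_ofReal_mul]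
    simp
    ring
  have hgen : ∀ n, φ (P.gen n) = ψ (P.gen n) := fun n => by
    have h1 := h (2 * n)
    have h2 := h (2 * n + 1)
    rw [hre, hre, mul_right_inj' (by positivity)] at h1
    rw [him, him, mul_right_inj' (by positivity)] at h2
    exact Complex.ext (by linarith) (by linarith)
  have hadj : Set.EqOn φ ψ (NonUnitalStarAlgebra.adjoin ℂ (Set.range P.gen) : Set A) := by
    intro a ha
    have ha' : a ∈ NonUnitalAlgebra.adjoin ℂ (Set.range P.gen ∪ star (Set.range P.gen)) := ha
    induction ha' using NonUnitalAlgebra.adjoin_induction with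
    | mem x hx =>
      rcases hx with ⟨n, rfl⟩ | ⟨n, hn⟩
      · exact hgen n
      · rw [← star_star x, ← hn, map_star, map_star, hgen]
    | add x y hx hy ihx ihy => rw [map_add, map_add, ihx hx, ihy hy]
    | zero => rw [map_zero, map_zero]
    | mul x y hx hy ihx ihy => rw [map_mul, map_mul, ihx hx, ihy hy]
    | smul r x hx ihx => rw [map_smul, map_smul, ihx hx]
  have hφψ : (φ : A → ℂ) = ψ :=
    Continuous.ext_on P.dense_adjoin (map_continuous φ) (map_continuous ψ) hadj
  exact DFunLike.coe_injective hφψ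

end Coordinates

/-! ### Least penalties as norms -/

/-- A bound of the penalty for a constraint on a coordinate with values in `[-1, 1]`. -/
def cap (e : Constraint) : ℕ := e.2.2 * (1 + (e.2.1.1 + e.2.1.2.1)) ^ 2

/-- A bound of the penalty for a list of constraints on coordinates with values in `[-1, 1]`. -/
def capSum (s : List Constraint) : ℕ := (s.map cap).sum

theorem primrec_cap : Primrec cap := by
  have h1 : Primrec fun e : Constraint => e.2.2 := Primrec.snd.comp .snd
  have h2 : Primrec fun e : Constraint => e.2.1.1 := Primrec.fst.comp (Primrec.fst.comp .snd)
  have h3 : Primrec fun e : Constraint => e.2.1.2.1 :=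
    Primrec.fst.comp (Primrec.snd.comp (Primrec.fst.comp .snd))
  exact Primrec.nat_mul.comp h1 (primrec_nat_pow.comp
    (Primrec.nat_add.comp (.const 1) (Primrec.nat_add.comp h2 h3)) (.const 2))

theorem computable_capSum : Computable capSum :=
  computable_list_sum (Primrec.list_map .id (primrec_cap.comp .snd).to₂).to_comp

theorem mul_sq_sub_toRat_le_cap (e : Constraint) {y : ℝ} (hy : |y| ≤ 1) :
    (e.2.2 : ℝ) * (y - (e.2.1.toRat : ℚ)) ^ 2 ≤ cap e := by
  have h1 := RatCode.abs_toRat_le e.2.1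
  have h2 : |y - (e.2.1.toRat : ℚ)| ≤ 1 + (e.2.1.1 + e.2.1.2.1) :=
    (abs_sub _ _).trans (add_le_add hy h1)
  rw [cap, ← sq_abs]
  push_cast
  gcongr

theorem penalty_le_capSum {X : Type*} {h : ℕ → X → ℝ} (hb : ∀ i x, |h i x| ≤ 1)
    (s : List Constraint) (x : X) : penalty h s x ≤ capSum s := by
  induction s with
  | nil => simp [penalty, capSum]
  | cons e s ih =>
    have h1 := mul_sq_sub_toRat_le_cap e (hb e.1 x)
    simp only [penalty, capSum, List.map_cons, List.sum_cons] at ih ⊢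
    rw [Nat.cast_add]
    exact add_le_add h1 ih

/-- A rational `*`-polynomial for `cap e - C (u i - q)²`, where `(i, q, C) = e`, `U i` is a
polynomial for `u i` and `p` is one for the unit. -/
def gapTerm (U : ℕ → RatStarPoly) (p : RatStarPoly) (e : Constraint) : RatStarPoly :=
  RatStarPoly.smul (RatCode.ofNat e.2.2).neg ((U e.1).mul (U e.1)) ++
    (RatStarPoly.smul ((RatCode.ofNat (2 * e.2.2)).mul e.2.1) (U e.1) ++
      RatStarPoly.smul ((RatCode.ofNat (cap e)).add
        ((RatCode.ofNat e.2.2).mul (e.2.1.mul e.2.1)).neg) p)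

/-- A rational `*`-polynomial for the difference of `capSum s` and the penalty for `s`. -/
def gapPoly (U : ℕ → RatStarPoly) (p : RatStarPoly) (s : List Constraint) : RatStarPoly :=
  s.flatMap (gapTerm U p)

theorem computable_gapPoly {α : Type*} [Primcodable α] {U : ℕ → RatStarPoly} (hU : Computable U)
    {f : α → RatStarPoly} {g : α → List Constraint} (hf : Computable f) (hg : Computable g) :
    Computable fun a => gapPoly U (f a) (g a) := by
  refine computable_list_flatMap hg (g := fun a e => gapTerm U (f a) e) ?_
  have hu : Computable fun x : α × Constraint => U x.2.1 := hU.comp (Computable.fst.comp .snd)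
  have hp : Computable fun x : α × Constraint => f x.1 := hf.comp .fst
  have h1 : Primrec fun e : Constraint => (RatCode.ofNat e.2.2).neg :=
    RatCode.primrec_neg.comp (RatCode.primrec_ofNat.comp (Primrec.snd.comp .snd))
  have h2 : Primrec fun e : Constraint => (RatCode.ofNat (2 * e.2.2)).mul e.2.1 :=
    RatCode.primrec_mul.comp (RatCode.primrec_ofNat.comp
      (Primrec.nat_mul.comp (.const 2) (Primrec.snd.comp .snd))) (Primrec.fst.comp .snd)
  have h3 : Primrec fun e : Constraint => (RatCode.ofNat (cap e)).add
      ((RatCode.ofNat e.2.2).mul (e.2.1.mul e.2.1)).neg :=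
    RatCode.primrec_add.comp (RatCode.primrec_ofNat.comp primrec_cap)
      (RatCode.primrec_neg.comp (RatCode.primrec_mul.comp
        (RatCode.primrec_ofNat.comp (Primrec.snd.comp .snd))
        (RatCode.primrec_mul.comp (Primrec.fst.comp .snd) (Primrec.fst.comp .snd))))
  have hs := RatStarPoly.primrec_smul.to_comp
  exact Computable.list_append.comp
    (hs.comp (h1.to_comp.comp .snd) (RatStarPoly.primrec_mul.to_comp.comp hu hu))
    (Computable.list_append.comp (hs.comp (h2.to_comp.comp .snd) hu)
      (hs.comp (h3.to_comp.comp .snd) hp))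

section Gap

variable {A : Type*} [CommCStarAlgebra A]

/-- The element of the algebra that is the difference of `capSum s` and the penalty for `s`. -/
noncomputable def gapElement (u : ℕ → A) (s : List Constraint) : A :=
  (s.map fun e => (cap e : ℂ) • (1 : A) -
    (e.2.2 : ℂ) • ((u e.1 - (e.2.1.toRat : ℂ) • 1) * (u e.1 - (e.2.1.toRat : ℂ) • 1))).sum

theorem evalPoly_gapTerm_sub (v : ℕ → A) (U : ℕ → RatStarPoly) (p : RatStarPoly) (e : Constraint) :
    evalPoly v (gapTerm U p e) - ((cap e : ℂ) • (1 : A) -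
      (e.2.2 : ℂ) • ((evalPoly v (U e.1) - (e.2.1.toRat : ℂ) • 1) *
        (evalPoly v (U e.1) - (e.2.1.toRat : ℂ) • 1))) =
      ((cap e - e.2.2 * (0 - (e.2.1.toRat : ℚ)) ^ 2 : ℝ) : ℂ) • (evalPoly v p - 1) := by
  simp only [gapTerm, RatStarPoly.evalPoly_append, RatStarPoly.evalPoly_smul,
    RatStarPoly.evalPoly_mul, RatCode.toRat_add, RatCode.toRat_mul, RatCode.toRat_neg,
    RatCode.toRat_ofNat]
  push_cast
  simp only [Algebra.smul_def, map_add, map_mul, map_neg, map_sub, map_pow, map_ofNat, map_natCast,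
    map_zero]
  ring

/-- Only the constant terms change when the unit is replaced by `p`, and the coefficient cap e - C
q² of each lies between 0 and `cap e`. -/
theorem norm_evalPoly_gapPoly_sub_le (v : ℕ → A) (U : ℕ → RatStarPoly) (p : RatStarPoly)
    (s : List Constraint) :
    ‖evalPoly v (gapPoly U p s) - gapElement (fun i => evalPoly v (U i)) s‖ ≤
      capSum s * ‖evalPoly v p - 1‖ := by
  induction s with
  | nil => simp [gapPoly, gapElement, capSum, RatStarPoly.evalPoly_nil]
  | cons e s ih =>
    have h1 : gapPoly U p (e :: s) = gapTerm U p e ++ gapPoly U p s := rfl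
    have h2 : capSum (e :: s) = cap e + capSum s := by simp [capSum]
    rw [h1, h2, RatStarPoly.evalPoly_append]
    have h3 : gapElement (fun i => evalPoly v (U i)) (e :: s) = ((cap e : ℂ) • (1 : A) -
      (e.2.2 : ℂ) • ((evalPoly v (U e.1) - (e.2.1.toRat : ℂ) • 1) *
        (evalPoly v (U e.1) - (e.2.1.toRat : ℂ) • 1))) +
          gapElement (fun i => evalPoly v (U i)) s := by simp [gapElement]
    rw [h3, add_sub_add_comm, evalPoly_gapTerm_sub]
    push_cast [add_mul]
    refine (norm_add_le _ _).trans (add_le_add ?_ ih)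
    rw [norm_smul]
    gcongr
    -- The case y = 0 of the cap bound says C q² ≤ cap e, so the coefficient is nonnegative and
    -- equals its norm.
    have h4 := mul_sq_sub_toRat_le_cap e (y := 0) (by simp)
    have h5 : 0 ≤ (e.2.2 : ℝ) * (0 - (e.2.1.toRat : ℚ)) ^ 2 := by positivity
    have h6 := Complex.norm_of_nonneg (sub_nonneg.2 h4)
    push_cast at h6 h5 ⊢
    rw [h6]
    linarith

variable {u : ℕ → A}

theorem apply_gapElement (hu : ∀ i, IsSelfAdjoint (u i)) (φ : WeakDual.characterSpace ℂ A)
    (s : List Constraint) : φ (gapElement u s) =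
      ((capSum s - penalty (fun i φ => (φ (u i)).re) s φ : ℝ) : ℂ) := by
  have hre : ∀ i, φ (u i) = ((φ (u i)).re : ℂ) := fun i => by
    rw [eq_comm, ← Complex.conj_eq_iff_re, ← Complex.star_def, ← map_star, (hu i).star_eq]
  induction s with
  | nil => simp [gapElement, capSum, penalty]
  | cons e s ih =>
    simp only [gapElement, capSum, penalty, List.map_cons, List.sum_cons] at ih ⊢
    rw [map_add, ih, map_sub, map_smul, map_smul, map_mul, map_sub, map_smul, map_one, hre e.1]
    push_cast
    simp only [smul_eq_mul, Complex.ofReal_re]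
    ring

theorem abs_re_apply_le_one [Nontrivial A] (hn : ∀ i, ‖u i‖ ≤ 1) (i : ℕ) (φ : WeakDual.characterSpace ℂ A) :
    |(φ (u i)).re| ≤ 1 :=
  (Complex.abs_re_le_norm _).trans ((AlgHom.norm_apply_le_self φ (u i)).trans (hn i))

theorem norm_apply_gapElement [Nontrivial A] (hu : ∀ i, IsSelfAdjoint (u i)) (hn : ∀ i, ‖u i‖ ≤ 1)
    (φ : WeakDual.characterSpace ℂ A) (s : List Constraint) : ‖φ (gapElement u s)‖ =
      capSum s - penalty (fun i (φ : WeakDual.characterSpace ℂ A) => (φ (u i)).re) s φ := by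
  rw [apply_gapElement hu, Complex.norm_of_nonneg]
  exact sub_nonneg.2 (penalty_le_capSum (abs_re_apply_le_one hn) s φ)

/-- The Gelfand transform is isometric, and its sup norm is attained on the compact, nonempty
spectrum. -/
theorem exists_norm_apply_eq_norm [Nontrivial A] (a : A) :
    ∃ φ : WeakDual.characterSpace ℂ A, ‖φ a‖ = ‖a‖ := by
  have h1 : ‖WeakDual.gelfandTransform ℂ A a‖ = ‖a‖ :=
    (gelfandTransform_isometry A).norm_map_of_map_zero (map_zero _) a
  obtain ⟨φ, -, hφ⟩ := isCompact_univ.exists_isMaxOn Set.univ_nonempty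
    (f := fun φ : WeakDual.characterSpace ℂ A => ‖φ a‖)
    ((WeakDual.gelfandTransform ℂ A a).continuous.norm.continuousOn)
  refine ⟨φ, le_antisymm (AlgHom.norm_apply_le_self φ a) ?_⟩
  rw [← h1]
  exact (ContinuousMap.norm_le _ (norm_nonneg _)).2 fun ψ => hφ (Set.mem_univ ψ)

theorem isComputableFamily_capSum_sub_norm (P : CStarPresentation A) (hP : P.IsComputable)
    {U : ℕ → RatStarPoly} (hU : Computable U) : IsComputableFamily fun s =>
      (capSum s : ℝ) - ‖gapElement (fun i => evalPoly P.gen (U i)) s‖ := by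
  obtain ⟨q, hq, hqN⟩ := hP
  obtain ⟨p, hp⟩ := Metric.denseRange_iff.1 P.denseRange_rationalVector 1 2⁻¹ (by norm_num)
  rw [dist_comm, dist_eq_norm] at hp
  -- The unit is approximated to within 2^-(capSum s + k + 1); since K ≤ 2^K, the factor `capSum s`
  -- still leaves an error of at most 2^-(k+1). The other half of the allowance is for `q`.
  let r : List Constraint → ℕ → RatCode := fun s k =>
    q (gapPoly U (unitApprox p (capSum s + k)) s) (k + 1)
  have hr : Computable₂ r := by
    have hs : Computable fun x : List Constraint × ℕ => x.1 := .fst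
    refine hq.comp (computable_gapPoly hU ((primrec_unitApprox p).to_comp.comp
      (Primrec.nat_add.to_comp.comp (computable_capSum.comp hs) .snd)) hs)
      (Computable.succ.comp .snd)
  -- This is the code of `capSum s` minus the number coded by `r s k`, over the same denominator.
  refine ⟨fun s k => (capSum s * ((r s k).2.2 + 1) + (r s k).2.1, (r s k).1, (r s k).2.2), ?_, ?_⟩
  · have hc : Computable fun x : List Constraint × ℕ => capSum x.1 := computable_capSum.comp .fst
    have hr2 := Computable.snd.comp hr
    have hr22 := Computable.snd.comp hr2
    exact Computable.pair (Primrec.nat_add.to_comp.comp (Primrec.nat_mul.to_comp.comp hc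
      (Computable.succ.comp hr22)) (Computable.fst.comp hr2))
      (Computable.pair (Computable.fst.comp hr) hr22)
  · intro s k
    have h1 := hqN (gapPoly U (unitApprox p (capSum s + k)) s) (k + 1)
    have h2 := norm_evalPoly_gapPoly_sub_le P.gen U (unitApprox p (capSum s + k)) s
    have h3 := norm_evalPoly_unitApprox_sub_one_le P.gen hp.le (capSum s + k)
    have h4 := abs_norm_sub_norm_le (evalPoly P.gen (gapPoly U (unitApprox p (capSum s + k)) s))
      (gapElement (fun i => evalPoly P.gen (U i)) s)
    have h5 : (capSum s : ℝ) * ‖evalPoly P.gen (unitApprox p (capSum s + k)) - 1‖ ≤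
        (2 : ℝ)⁻¹ ^ (k + 1) := by
      refine (mul_le_mul_of_nonneg_left h3 (by positivity)).trans ?_
      rw [add_assoc, pow_add, ← mul_assoc]
      refine mul_le_of_le_one_left (by positivity) ?_
      rw [inv_pow, ← div_eq_mul_inv]
      exact div_le_one_of_le₀ (by exact_mod_cast Nat.lt_two_pow_self.le) (by positivity)
    have h6 := h4.trans (h2.trans h5)
    have h7 : ((RatCode.toRat (capSum s * ((r s k).2.2 + 1) + (r s k).2.1, (r s k).1,
        (r s k).2.2) : ℚ) : ℝ) = capSum s - ((r s k).toRat : ℚ) := by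
      simp only [RatCode.toRat]
      push_cast
      field_simp
      ring
    rw [h7, sub_sub_sub_cancel_left, abs_sub_comm]
    refine (abs_sub_le _ ‖evalPoly P.gen (gapPoly U (unitApprox p (capSum s + k)) s)‖ _).trans_lt ?_
    refine (add_lt_add_of_lt_of_le h1 h6).trans_eq ?_
    rw [pow_succ]; ring

end Gap

theorem CStarPresentation.IsComputable.exists_norm_gen_le {A : Type*} [NonUnitalCStarAlgebra A]
    {P : CStarPresentation A} (hP : P.IsComputable) :
    ∃ B : ℕ → ℕ, Computable B ∧ ∀ n, 2 * ‖P.gen n‖ ≤ B n + 1 := by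
  obtain ⟨q, hq, hqN⟩ := hP
  let g : ℕ → RatStarPoly := fun n => [((RatCode.ofNat 1, RatCode.ofNat 0), (n, false), [])]
  have hg : Primrec g := Primrec.list_cons.comp (Primrec.pair (.const _)
    (Primrec.pair (Primrec.pair .id (.const false)) (.const []))) (.const [])
  have hgv : ∀ n, P.rationalVector (g n) = P.gen n := fun n => by
    simp [g, CStarPresentation.rationalVector, evalPoly, evalCoeff, evalWord, evalLetter,
      RatCode.toRat_ofNat]
  -- At precision 0 the approximation is within 1 of the norm, which explains the summand 1.
  refine ⟨fun n => 2 * ((q (g n) 0).1 + (q (g n) 0).2.1 + 1), ?_, fun n => ?_⟩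
  · have h : Computable fun n => q (g n) 0 := hq.comp hg.to_comp (.const 0)
    exact Primrec.nat_mul.to_comp.comp (.const 2) (Computable.succ.comp
      (Primrec.nat_add.to_comp.comp (Computable.fst.comp h)
        (Computable.fst.comp (Computable.snd.comp h))))
  · have h1 := (abs_lt.1 (hqN (g n) 0)).1
    have h2 := (abs_le.1 (RatCode.abs_toRat_le (q (g n) 0))).2
    simp only [hgv, pow_zero] at h1
    push_cast
    linarith

end CompGelfand

/-! ### The spectrum -/

theorem mainTheorem3 (A : Type*) [CommCStarAlgebra A] [Nontrivial A]
    (hA : CompGelfand.ComputablyPresentable A) :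
    CompGelfand.HasComputablyCompactPresentation (WeakDual.characterSpace ℂ A) := by
  obtain ⟨P, hP⟩ := hA
  obtain ⟨B, hB, hBn⟩ := hP.exists_norm_gen_le
  let U : ℕ → CompGelfand.RatStarPoly := fun i => CompGelfand.coordPoly (B i.div2) i
  have hU : Computable U := CompGelfand.primrec_coordPoly.to_comp.comp
    (hB.comp Computable.nat_div2) Computable.id
  let u : ℕ → A := fun i => CompGelfand.evalPoly P.gen (U i)
  have hsa : ∀ i, IsSelfAdjoint (u i) := fun i =>
    CompGelfand.isSelfAdjoint_evalPoly_coordPoly P.gen _ i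
  have hn : ∀ i, ‖u i‖ ≤ 1 := fun i =>
    CompGelfand.norm_evalPoly_coordPoly_le_one P.gen (hBn i.div2)
  have hcont : ∀ i, Continuous fun φ : WeakDual.characterSpace ℂ A => (φ (u i)).re := fun i =>
    Complex.continuous_re.comp (WeakDual.gelfandTransform ℂ A (u i)).continuous
  refine CompGelfand.hasComputablyCompactPresentation_of_penalty hcont
    (CompGelfand.abs_re_apply_le_one hn)
    (CompGelfand.ext_of_re_coordPoly_eq P fun i => B i.div2)
    (CompGelfand.isComputableFamily_capSum_sub_norm P hP hU) (fun s φ => ?_) fun s => ?_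
  · have h1 := CompGelfand.norm_apply_gapElement hsa hn φ s
    have h2 : ‖φ (CompGelfand.gapElement u s)‖ ≤ ‖CompGelfand.gapElement u s‖ :=
      AlgHom.norm_apply_le_self φ _
    exact sub_le_comm.1 (h1.symm.trans_le h2)
  -- A character at which the gap element attains its norm minimizes the penalty.
  · obtain ⟨φ, hφ⟩ := CompGelfand.exists_norm_apply_eq_norm (CompGelfand.gapElement u s)
    have h1 := CompGelfand.norm_apply_gapElement hsa hn φ s
    exact ⟨φ, eq_sub_of_add_eq' (add_eq_of_eq_sub (hφ.symm.trans h1))⟩
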